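/- Let $G=(V,E)$ be an undirected graph with positive edge weights and let $\mathcal P\subseteq V^2$. For a subgraph $S=(V,E')$ of $G$ (with the inherited weights) write $d_S(u,v)$ for the weighted shortest-path distance in $S$ ($\infty$ if there is no path), and similarly $d_G$. A $\mathcal P$-pairwise $\alpha$-spanner of $G$ is a subgraph $S=(V,E')$ such that $d_S(u,v)\le\alpha\, d_G(u,v)$ for every $(u,v)\in\mathcal P$. All iterated logarithms are in base $2$. **Theorem.** There is a universal constant $c>0$ such that for infinitely many integers $n>0$ and for any integer $1<\kappa\le\log\log n$ and any real $0<\epsilon<\frac1{12\kappa}$ (with $\epsilon$ not too small compared to $n$, as specified below), there are an $n$-vertex weighted graph $G=(V,E)$ and a set of pairs $\mathcal P\subseteq V^2$ with $$|\mathcal P|\ \ge\ n^{1+\frac1{2^{\kappa+1}-1}-o(1)}$$ such that every $\mathcal P$-pairwise $(1+\epsilon)$-spanner of $G$ has at least $\beta\cdot|\mathcal P|$ edges, where $\beta=\left(\frac{c}{\epsilon\kappa^2}\right)^{\kappa}$. Here the $o(1)$ term tends to $0$ as $\frac{\kappa^2\log(1/\epsilon)}{\log n}\to0$, uniformly in $\kappa$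 and $\epsilon$; in particular it tends to $0$ as $n\to\infty$ for every fixed $\epsilon$. Precisely: there are a constant $c>0$ and an infinite set $N$ of positive integers such that for every $\eta>0$ there is $\theta>0$ with the following property. For all $n\in N$, all integers $1<\kappa\le\log\log n$, and all reals $0<\epsilon<\frac1{12\kappa}$ with $\kappa^2\log(1/\epsilon)\le\theta\log n$, there are $G$ and $\mathcal P$ as above with $|\mathcal P|\ge n^{1+\frac1{2^{\kappa+1}-1}-\eta}$, such that every $\mathcal P$-pairwise $(1+\epsilon)$-spanner of $G$ has at least $\left(\frac{c}{\epsilon\kappa^2}\right)^{\kappa}|\mathcal P|$ edges. -/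

import Mathlib

open scoped NNReal ENNReal

/-- An undirected weighted graph on the vertex set `V`: a simple graph whose edges carry positive
weights. The values of `weight` on non-edges play no role. -/
structure WeightedGraph (V : Type*) where
  graph : SimpleGraph V
  weight : Sym2 V → ℝ≥0
  weight_pos : ∀ e ∈ graph.edgeSet, 0 < weight e

/-- The total weight of a walk in the graph `S`, with respect to the weights `w`. -/
def walkWeight {V : Type*} {S : SimpleGraph V} (w : Sym2 V → ℝ≥0) {u v : V} (q : S.Walk u v) :
    ℝ≥0 :=
  (q.edges.map w).sum

/-- The distance from `u` to `v` in the graph `S` with edge weights `w`: the least weight of a walk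
from `u` to `v` in `S`, and `∞` if there is none. -/
noncomputable def weightedDist {V : Type*} (S : SimpleGraph V) (w : Sym2 V → ℝ≥0) (u v : V) :
    ℝ≥0∞ :=
  ⨅ q : S.Walk u v, (walkWeight w q : ℝ≥0∞)

/-- `S` is a `P`-pairwise `α`-spanner of `G`: a subgraph on the same vertex set, with the weights
inherited from `G`, such that `d_S(u, v) ≤ α * d_G(u, v)` for every pair `(u, v)` in `P`. -/
def IsPairwiseSpanner {V : Type*} (G : WeightedGraph V) (P : Finset (V × V)) (α : ℝ)
    (S : SimpleGraph V) : Prop :=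
  S ≤ G.graph ∧ ∀ x ∈ P, weightedDist S G.weight x.1 x.2 ≤
    ENNReal.ofReal α * weightedDist G.graph G.weight x.1 x.2

/-! The lower bound comes from an iterated product of gadgets. Their invariant (`robust`) is that a
walk joining a pair has excess weight at least twice the number of critical darts of that pair it
misses. Hence a walk of excess less than |C| uses more than half of them, and as critical darts of
different pairs are distinct, a good spanner keeps a quarter of |C| times the number of pairs as
edges (`HasGadget.exists_spanner_bound`).

The base is a complete bipartite graph. The product (`Gadget.prod`) has r + 1 layers of plain
vertices indexed by H × H, with copies of the old gadget between consecutive layers; crossing a copy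
from port a to port b moves the position by (f a, f b). A pair (x, k) asks for r moves by the same
vector. If f is rigid, as for points of a Behrend sphere, no other r moves lead there, so a walk
that never turns back crosses r copies through the pair k and inherits their robustness. Attaching
edges weigh r|C|, so turning back costs 2r|C|, twice the number of all critical darts of the new
pair.

After κ products |C| = r^κ and the length is r^κ(1 + 2κr), so r of order 1/(εκ) suffices. Since |H|
is nearly the number of old ports, a initial ports give about a^(2^κ) ports, a^(2^(κ+1)) pairs and
a^(1+2+...+2^κ) = a^(2^(κ+1)-1) vertices, up to powers of r: this is the exponent 1 + 1/(2^(κ+1)-1).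
For large κ that exponent is within η of 1, and disjoint copies of a one-pair gadget suffice; this
makes the bounds uniform in κ. -/

/-- `WReach wt R u v t` holds if some walk from `u` to `v` along `R` has total weight `t`. -/
inductive WReach {V : Type*} (wt : V → V → ℕ) (R : V → V → Prop) : V → V → ℕ → Prop
  | nil (u : V) : WReach wt R u u 0
  | cons {u v x : V} {t : ℕ} (h : R u v) (q : WReach wt R v x t) : WReach wt R u x (wt u v + t)

namespace WReach

variable {V : Type*} {wt : V → V → ℕ} {R R' : V → V → Prop}

theorem mono (hR : ∀ u v, R u v → R' u v) {u v : V} {t : ℕ} (h : WReach wt R u v t) :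
    WReach wt R' u v t := by
  induction h with
  | nil u => exact nil u
  | cons h _ ih => exact cons (hR _ _ h) ih

theorem trans {u v x : V} {s t : ℕ} (h : WReach wt R u v s) (h' : WReach wt R v x t) :
    WReach wt R u x (s + t) := by
  induction h with
  | nil u => simpa using h'
  | cons h _ ih => rw [add_assoc]; exact cons h (ih h')

theorem single {u v : V} (h : R u v) : WReach wt R u v (wt u v) := by
  simpa using cons (wt := wt) h (nil v)

theorem map {V' : Type*} {wt' : V' → V' → ℕ} {R' : V' → V' → Prop} (φ : V → V')
    (hwt : ∀ u v, wt' (φ u) (φ v) = wt u v) (hR : ∀ u v, R u v → R' (φ u) (φ v))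
    {u v : V} {t : ℕ} (h : WReach wt R u v t) : WReach wt' R' (φ u) (φ v) t := by
  induction h with
  | nil u => exact nil _
  | cons h _ ih => rw [← hwt]; exact cons (hR _ _ h) ih

end WReach

/-! ### Gadgets and the base of the iteration -/

open scoped Classical in
/-- A weighted graph on `V` with entry and exit ports indexed by `A`, a family of pairs of ports
indexed by `I`, and for each pair a family of critical darts indexed by `C`. All the critical
darts of all pairs are distinct, and a walk that joins a pair and is nearly shortest has to use
most of the critical darts of the pair. -/
structure Gadget (A V I C : Type) [Fintype C] where
  Adj : V → V → Prop
  symm : ∀ u v, Adj u v → Adj v u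
  irrefl : ∀ u, ¬ Adj u u
  wt : V → V → ℕ
  wt_symm : ∀ u v, wt u v = wt v u
  wt_pos : ∀ u v, 0 < wt u v
  src : A → V
  src_injective : Function.Injective src
  tgt : A → V
  tgt_injective : Function.Injective tgt
  fst : I → A
  snd : I → A
  ends_injective : Function.Injective fun i => (fst i, snd i)
  crit : I → C → V × V
  crit_injective : Function.Injective fun p : I × C => crit p.1 p.2
  len : ℕ
  len_le : ∀ a b t, WReach wt Adj (src a) (tgt b) t → len ≤ t
  reach : ∀ i, WReach wt Adj (src (fst i)) (tgt (snd i)) len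
  -- Each missing critical dart costs 2 in weight: the least detour in a bipartite graph with unit
  -- weights.
  robust : ∀ R : V → V → Prop, (∀ u v, R u v → Adj u v) → ∀ i t,
    WReach wt R (src (fst i)) (tgt (snd i)) t →
      2 * Fintype.card C + len ≤
        2 * (Finset.univ.filter fun c => R (crit i c).1 (crit i c).2).card + t

/-- The complete bipartite graph with unit weights, each edge being critical for its ends. -/
def Gadget.bipartite (A : Type) : Gadget A (A ⊕ A) (A × A) Unit where
  Adj u v := u.isLeft ≠ v.isLeft
  symm u v h := h.symm
  irrefl u := by simp
  wt _ _ := 1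
  wt_symm _ _ := rfl
  wt_pos _ _ := one_pos
  src := Sum.inl
  src_injective := Sum.inl_injective
  tgt := Sum.inr
  tgt_injective := Sum.inr_injective
  fst := Prod.fst
  snd := Prod.snd
  ends_injective := fun _ _ h => h
  crit p _ := (Sum.inl p.1, Sum.inr p.2)
  crit_injective := by
    rintro ⟨⟨a, b⟩, c⟩ ⟨⟨a', b'⟩, c'⟩ h
    simpa using h
  len := 1
  len_le a b t h := by
    cases h with
    | cons _ _ => omega
  reach i := WReach.single (wt := fun _ _ => 1) (by simp)
  robust R hR i t h := by
    -- By parity a walk between the sides is either the critical edge itself or has length at least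
    -- 3.
    have key : ∀ u v t, WReach (fun _ _ : A ⊕ A => 1) R u v t → (u.isLeft = v.isLeft ↔ Even t) := by
      intro u v t h
      induction h with
      | nil u => simp
      | cons h q ih =>
        have := hR _ _ h
        rw [add_comm, Nat.even_add_one, ← ih]
        revert this
        cases Sum.isLeft _ <;> cases Sum.isLeft _ <;> cases Sum.isLeft _ <;> simp
    have hodd := key _ _ _ h
    simp only [Sum.isLeft_inl, Sum.isLeft_inr, Bool.true_eq_false, false_iff,
      Nat.not_even_iff_odd] at hodd
    obtain ⟨k, rfl⟩ := hodd
    rcases k with _ | k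
    · have hadj : R (Sum.inl i.1) (Sum.inr i.2) := by
        generalize hs : 2 * 0 + 1 = s at h
        cases h with
        | cons h q =>
          cases q with
          | nil => exact h
          | cons _ _ => omega
      simp [hadj]
    · simp only [Fintype.card_unit]
      omega

/-! ### Rigid families and the product of gadgets -/

/-- Sums of `r` values of `f` determine their terms as soon as they agree with a constant sum. -/
def IsRigid {A H : Type*} [AddCommGroup H] (r : ℕ) (f : A → H) : Prop :=
  ∀ (l : List A) (a : A), l.length = r → (l.map f).sum = r • f a → ∀ b ∈ l, b = a

theorem IsRigid.smul_injective {A H : Type*} [AddCommGroup H] {r : ℕ} {f : A → H}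
    (hf : IsRigid r f) (hr : 0 < r) {a b : A} (h : r • f a = r • f b) : a = b :=
  hf (List.replicate r a) b (by simp) (by simpa using h) a (by simp [hr.ne'])

namespace Gadget

variable {A V I C H : Type} [Fintype C] [AddCommGroup H] (g : Gadget A V I C) (f : A → H) (r : ℕ)

/-- How the plain vertex at position `x` of layer `i` is attached to the vertex `v` of the copy of
`g` at position `z` of layer `j`. -/
def Attached (i : ℕ) (x : H × H) (j : ℕ) (z : H × H) (v : V) : Prop :=
  (∃ a, i = j ∧ z = x + (f a, 0) ∧ v = g.src a) ∨
    ∃ b, i = j + 1 ∧ x = z + (0, f b) ∧ v = g.tgt b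

/-- The adjacency of the product: plain vertices in `r + 1` layers, and copies of `g` between them.
-/
def prodAdj : (Fin (r + 1) × H × H) ⊕ (Fin r × (H × H) × V) →
    (Fin (r + 1) × H × H) ⊕ (Fin r × (H × H) × V) → Prop
  | Sum.inl _, Sum.inl _ => False
  | Sum.inl (i, x), Sum.inr (j, z, v) => g.Attached f i x j z v
  | Sum.inr (j, z, v), Sum.inl (i, x) => g.Attached f i x j z v
  | Sum.inr (j, z, u), Sum.inr (j', z', v) => j = j' ∧ z = z' ∧ g.Adj u v

/-- The weights of the product. -/
def prodWt : (Fin (r + 1) × H × H) ⊕ (Fin r × (H × H) × V) →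
    (Fin (r + 1) × H × H) ⊕ (Fin r × (H × H) × V) → ℕ
  | Sum.inr (_, _, u), Sum.inr (_, _, v) => g.wt u v
  | Sum.inr _, Sum.inl _ => r * Fintype.card C
  | Sum.inl _, _ => r * Fintype.card C

/-- The relation that `R` induces on the copy of `V` at position `z` of layer `i`. -/
def copyRel {r : ℕ} (R : (Fin (r + 1) × H × H) ⊕ (Fin r × (H × H) × V) →
    (Fin (r + 1) × H × H) ⊕ (Fin r × (H × H) × V) → Prop) (i : ℕ) (z : H × H) (u v : V) : Prop :=
  ∃ h : i < r, R (Sum.inr (⟨i, h⟩, z, u)) (Sum.inr (⟨i, h⟩, z, v))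

/-- The weight of a shortest traversal of one layer of the product. -/
def layerLen : ℕ := 2 * (r * Fintype.card C) + g.len

variable {r}

/-- A walk of weight at most `t` from position `x` of layer `i` to position `y` of the last layer
that never turns back, the list recording the ports used. -/
def Chain (R : (Fin (r + 1) × H × H) ⊕ (Fin r × (H × H) × V) →
    (Fin (r + 1) × H × H) ⊕ (Fin r × (H × H) × V) → Prop) (y : H × H) :
    List (A × A) → ℕ → H × H → ℕ → Prop
  | [], i, x, _ => i = r ∧ x = y
  | p :: l, i, x, t => ∃ t₀ t₁, WReach g.wt (copyRel R i (x + (f p.1, 0))) (g.src p.1) (g.tgt p.2) t₀ ∧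
      t₀ + 2 * (r * Fintype.card C) + t₁ ≤ t ∧ Chain R y l (i + 1) (x + (f p.1, f p.2)) t₁

/-- What is known of a walk of weight `t` from a plain vertex to the last layer. -/
def FromPlain (R : (Fin (r + 1) × H × H) ⊕ (Fin r × (H × H) × V) →
    (Fin (r + 1) × H × H) ⊕ (Fin r × (H × H) × V) → Prop) (y : H × H) (i : ℕ) (x : H × H)
    (t : ℕ) : Prop :=
  r * g.layerLen r + 2 * (r * Fintype.card C) ≤ t + i * g.layerLen r ∨ ∃ l, g.Chain f R y l i x t

/-- What is known of a walk of weight `t` from a vertex of a copy to the last layer. -/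
def FromCopy (R : (Fin (r + 1) × H × H) ⊕ (Fin r × (H × H) × V) →
    (Fin (r + 1) × H × H) ⊕ (Fin r × (H × H) × V) → Prop) (y : H × H) (j : ℕ) (z : H × H) (v : V)
    (t : ℕ) : Prop :=
  r * g.layerLen r + r * Fintype.card C ≤ t + j * g.layerLen r ∨
    ∃ b t₀ t₁, WReach g.wt (copyRel R j z) v (g.tgt b) t₀ ∧ t₀ + r * Fintype.card C + t₁ ≤ t ∧
      g.FromPlain f R y (j + 1) (z + (0, f b)) t₁

variable {g f} {R : (Fin (r + 1) × H × H) ⊕ (Fin r × (H × H) × V) →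
    (Fin (r + 1) × H × H) ⊕ (Fin r × (H × H) × V) → Prop}

theorem copyRel_le (hR : ∀ u v, R u v → g.prodAdj f r u v) (i : ℕ) (z : H × H) (u v : V)
    (h : copyRel R i z u v) : g.Adj u v := by
  obtain ⟨h, h'⟩ := h
  exact (hR _ _ h').2.2

theorem Chain.length {y : H × H} : ∀ {l : List (A × A)} {i : ℕ} {x : H × H} {t : ℕ},
    g.Chain f R y l i x t → i + l.length = r
  | [], i, x, t, h => h.1
  | p :: l, i, x, t, h => by
    obtain ⟨_, _, _, _, h⟩ := h
    have := Chain.length h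
    simp only [List.length_cons]
    omega

theorem Chain.sum {y : H × H} : ∀ {l : List (A × A)} {i : ℕ} {x : H × H} {t : ℕ},
    g.Chain f R y l i x t →
      x + ((l.map fun p => f p.1).sum, (l.map fun p => f p.2).sum) = y
  | [], i, x, t, h => by
    rw [← h.2]
    exact add_zero x
  | p :: l, i, x, t, h => by
    obtain ⟨_, _, _, _, h⟩ := h
    have := Chain.sum h
    rw [← this, add_assoc]
    rfl

theorem Chain.le (hR : ∀ u v, R u v → g.prodAdj f r u v) {y : H × H} :
    ∀ {l : List (A × A)} {i : ℕ} {x : H × H} {t : ℕ},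
    g.Chain f R y l i x t → r * g.layerLen r ≤ t + i * g.layerLen r
  | [], i, x, t, h => by
    rw [h.1]
    omega
  | p :: l, i, x, t, h => by
    obtain ⟨t₀, t₁, h₀, h₁, h⟩ := h
    have := Chain.le hR h
    have hl := g.len_le _ _ _ (h₀.mono (copyRel_le hR _ _))
    have hL : g.layerLen r = 2 * (r * Fintype.card C) + g.len := rfl
    rw [add_mul, one_mul] at this
    omega

theorem FromPlain.le (hR : ∀ u v, R u v → g.prodAdj f r u v) {y : H × H} {i : ℕ} {x : H × H}
    {t : ℕ} (h : g.FromPlain f R y i x t) : r * g.layerLen r ≤ t + i * g.layerLen r := by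
  rcases h with h | ⟨l, h⟩
  · omega
  · exact h.le hR

/-- Induction along the walk, comparing its weight with `layerLen` per remaining layer. Leaving a
copy on the side by which it was entered uses two attaching edges without progress, hence an excess
of 2r|C|. From inside a copy only r|C| is recorded, as the edge leading into it is paid separately.
-/
theorem from_of_reach (hR : ∀ u v, R u v → g.prodAdj f r u v) {y : H × H} {u v} {t : ℕ}
    (h : WReach (g.prodWt r) R u v t) (hv : v = Sum.inl (Fin.last r, y)) :
    (∀ i x, u = Sum.inl (i, x) → g.FromPlain f R y i x t) ∧
      ∀ j z w, u = Sum.inr (j, z, w) → g.FromCopy f R y j z w t := by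
  have hL : g.layerLen r = 2 * (r * Fintype.card C) + g.len := rfl
  induction h with
  | nil u =>
    subst hv
    refine ⟨?_, by simp⟩
    intro i x h
    simp only [Sum.inl.injEq, Prod.mk.injEq] at h
    exact Or.inr ⟨[], by rw [← h.1]; rfl, h.2.symm⟩
  | @cons u u' _ t h q ih =>
    obtain ⟨ih₁, ih₂⟩ := ih hv
    have hadj := hR _ _ h
    rcases u with ⟨i, x⟩ | ⟨j, z, w⟩ <;> rcases u' with ⟨i', x'⟩ | ⟨j', z', w'⟩
    · exact hadj.elim
    · refine ⟨?_, by simp⟩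
      intro _ _ he
      simp only [Sum.inl.injEq, Prod.mk.injEq] at he
      obtain ⟨rfl, rfl⟩ := he
      have hwt : g.prodWt (H := H) r (Sum.inl (i, x)) (Sum.inr (j', z', w')) =
        r * Fintype.card C := rfl
      rw [hwt]
      have ih := ih₂ _ _ _ rfl
      rcases hadj with ⟨a, hi, hz, hw⟩ | ⟨b, hi, hz, hw⟩
      · rcases ih with ih | ⟨b, t₀, t₁, h₀, ht, h₁⟩
        · left
          rw [hi]
          omega
        · subst hw
          have hl := g.len_le _ _ _ (h₀.mono (copyRel_le hR _ _))
          rw [← hi] at h₀ h₁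
          rcases h₁ with h₁ | ⟨l, h₁⟩
          · left
            rw [add_mul, one_mul] at h₁
            omega
          · right
            refine ⟨(a, b) :: l, t₀, t₁, ?_, by omega, ?_⟩
            · rw [← hz]
              exact h₀
            · rw [hz, add_assoc] at h₁
              simpa using h₁
      -- The copy is entered backwards, through an exit port, so this edge and the next one out are
      -- both wasted.
      · left
        rw [hi, add_mul, one_mul]
        rcases ih with ih | ⟨b', t₀, t₁, h₀, ht, h₁⟩
        · omega
        · have := h₁.le hR
          rw [add_mul, one_mul] at this
          omega
    · refine ⟨by simp, ?_⟩
      intro _ _ _ he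
      simp only [Sum.inr.injEq, Prod.mk.injEq] at he
      obtain ⟨rfl, rfl, rfl⟩ := he
      have hwt : g.prodWt (H := H) r (Sum.inr (j, z, w)) (Sum.inl (i', x')) =
        r * Fintype.card C := rfl
      rw [hwt]
      have ih := ih₁ _ _ rfl
      rcases hadj with ⟨a, hi, hz, hw⟩ | ⟨b, hi, hz, hw⟩
      -- The walk leaves through an entry port, back to layer j, where all r - j layers remain to be
      -- crossed.
      · left
        have := ih.le hR
        rw [hi] at this
        omega
      · right
        refine ⟨b, 0, t, ?_, by omega, ?_⟩
        · rw [hw]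
          exact WReach.nil _
        · rw [← hz, ← hi]
          exact ih
    · refine ⟨by simp, ?_⟩
      intro _ _ _ he
      simp only [Sum.inr.injEq, Prod.mk.injEq] at he
      obtain ⟨rfl, rfl, rfl⟩ := he
      have hwt : g.prodWt (H := H) r (Sum.inr (j, z, w)) (Sum.inr (j', z', w')) = g.wt w w' := rfl
      rw [hwt]
      obtain ⟨rfl, rfl, -⟩ := hadj
      rcases ih₂ _ _ _ rfl with ih | ⟨b, t₀, t₁, h₀, ht, h₁⟩
      · left
        omega
      · right
        exact ⟨b, g.wt w w' + t₀, t₁, WReach.cons ⟨j.2, h⟩ h₀, by omega, h₁⟩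

-- If every layer is crossed through the ports of the pair k, adding up the robustness of g over the
-- r copies visited bounds the weight by the critical darts missing.
open scoped Classical in
theorem Chain.count (hR : ∀ u v, R u v → g.prodAdj f r u v) {y x : H × H} (k : I) :
    ∀ {l : List (A × A)} {i t : ℕ}, (∀ p ∈ l, p = (g.fst k, g.snd k)) →
      g.Chain f R y l i (x + i • (f (g.fst k), f (g.snd k))) t →
      r * (2 * Fintype.card C + g.layerLen r) ≤ i * (2 * Fintype.card C + g.layerLen r) + t +
        2 * ∑ j ∈ Finset.Ico i r, (Finset.univ.filter fun c =>
          copyRel R j (x + j • (f (g.fst k), f (g.snd k)) + (f (g.fst k), 0))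
            (g.crit k c).1 (g.crit k c).2).card
  | [], i, t, hl, h => by
    rw [h.1]
    omega
  | p :: l, i, t, hl, h => by
    have hlen := h.length
    simp only [List.length_cons] at hlen
    obtain ⟨t₀, t₁, h₀, h₁, h⟩ := h
    obtain rfl := hl p (by simp)
    have hs : x + i • (f (g.fst k), f (g.snd k)) + (f (g.fst k), f (g.snd k)) =
        x + (i + 1) • (f (g.fst k), f (g.snd k)) := by
      rw [add_smul, one_smul, add_assoc]
    simp only at h h₀
    rw [hs] at h
    have ih := Chain.count hR k (fun p hp => hl p (by simp [hp])) h
    have hrob := g.robust _ (copyRel_le hR _ _) k _ h₀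
    rw [Finset.sum_eq_sum_Ico_succ_bot (by omega)]
    have hL : g.layerLen r = 2 * (r * Fintype.card C) + g.len := rfl
    rw [add_mul, one_mul] at ih
    omega

theorem reach_prod (x : H × H) (k : I) (i : ℕ) (hi : i < r + 1) :
    WReach (g.prodWt r) (g.prodAdj f r) (Sum.inl (0, x))
      (Sum.inl (⟨i, hi⟩, x + i • (f (g.fst k), f (g.snd k)))) (i * g.layerLen r) := by
  induction i with
  | zero => simpa using WReach.nil _
  | succ i ih =>
    have h₀ := ih (by omega)
    have hir : i < r := by omega
    set p := x + i • (f (g.fst k), f (g.snd k)) with hp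
    have h₁ : g.prodAdj f r (Sum.inl (⟨i, by omega⟩, p))
        (Sum.inr (⟨i, hir⟩, p + (f (g.fst k), 0), g.src (g.fst k))) :=
      Or.inl ⟨_, rfl, rfl, rfl⟩
    have h₂ : g.prodAdj f r (Sum.inr (⟨i, hir⟩, p + (f (g.fst k), 0), g.tgt (g.snd k)))
        (Sum.inl (⟨i + 1, hi⟩, x + (i + 1) • (f (g.fst k), f (g.snd k)))) := by
      refine Or.inr ⟨g.snd k, rfl, ?_, rfl⟩
      rw [add_smul, one_smul, hp]
      simp only [add_assoc]
      simp
    have h₃ := (g.reach k).map (wt' := g.prodWt (H := H) r) (R' := g.prodAdj f r)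
      (fun v => Sum.inr (⟨i, hir⟩, p + (f (g.fst k), 0), v)) (fun _ _ => rfl)
      (fun _ _ h => ⟨rfl, rfl, h⟩)
    have := ((h₀.trans (WReach.single h₁)).trans h₃).trans (WReach.single h₂)
    convert this using 1
    simp only [prodWt, layerLen]
    ring

/-- The product of the layered graph with positions `H × H` and the gadget `g`. -/
def prod [Nonempty C] (g : Gadget A V I C) (f : A → H) (r : ℕ) (hr : 0 < r) (hf : IsRigid r f) :
    Gadget (H × H) ((Fin (r + 1) × H × H) ⊕ (Fin r × (H × H) × V)) ((H × H) × I) (Fin r × C) where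
  Adj := g.prodAdj f r
  symm := by
    rintro (⟨i, x⟩ | ⟨j, z, w⟩) (⟨i', x'⟩ | ⟨j', z', w'⟩) h
    · exact h
    · exact h
    · exact h
    · exact ⟨h.1.symm, h.2.1.symm, g.symm _ _ h.2.2⟩
  irrefl := by
    rintro (⟨i, x⟩ | ⟨j, z, w⟩) h
    · exact h
    · exact g.irrefl _ h.2.2
  wt := g.prodWt r
  wt_symm := by
    rintro (⟨i, x⟩ | ⟨j, z, w⟩) (⟨i', x'⟩ | ⟨j', z', w'⟩)
    · rfl
    · rfl
    · rfl
    · exact g.wt_symm _ _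
  wt_pos := by
    have := Nat.mul_pos hr (Fintype.card_pos (α := C))
    rintro (⟨i, x⟩ | ⟨j, z, w⟩) (⟨i', x'⟩ | ⟨j', z', w'⟩)
    · exact this
    · exact this
    · exact this
    · exact g.wt_pos _ _
  src x := Sum.inl (0, x)
  src_injective x x' h := by simpa using h
  tgt x := Sum.inl (Fin.last r, x)
  tgt_injective x x' h := by simpa using h
  fst p := p.1
  snd p := p.1 + r • (f (g.fst p.2), f (g.snd p.2))
  ends_injective := by
    rintro ⟨x, k⟩ ⟨x', k'⟩ h
    simp only [Prod.mk.injEq] at h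
    obtain ⟨rfl, h⟩ := h
    have h' := add_left_cancel h
    simp only [Prod.smul_mk, Prod.mk.injEq] at h'
    have := @g.ends_injective k k' (Prod.ext (hf.smul_injective hr h'.1)
      (hf.smul_injective hr h'.2))
    rw [this]
  crit p c :=
    let z := p.1 + (c.1 : ℕ) • (f (g.fst p.2), f (g.snd p.2)) + (f (g.fst p.2), 0)
    (Sum.inr (c.1, z, (g.crit p.2 c.2).1), Sum.inr (c.1, z, (g.crit p.2 c.2).2))
  crit_injective := by
    rintro ⟨⟨x, k⟩, i, c⟩ ⟨⟨x', k'⟩, i', c'⟩ h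
    simp only [Prod.mk.injEq, Sum.inr.injEq] at h
    obtain ⟨⟨rfl, hx, h₁⟩, -, -, h₂⟩ := h
    -- A critical dart of g determines k and c; with k known, the position of the copy determines
    -- the start x.
    have := @g.crit_injective (k, c) (k', c') (Prod.ext h₁ h₂)
    simp only [Prod.mk.injEq] at this
    obtain ⟨rfl, rfl⟩ := this
    rw [add_right_cancel (add_right_cancel hx)]
  len := r * g.layerLen r
  len_le x y t h := by
    have := ((from_of_reach (fun _ _ h => h) h rfl).1 _ _ rfl).le (fun _ _ h => h)
    simpa using this
  reach p := reach_prod p.1 p.2 r (by omega)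
  robust R hR p t h := by
    classical
    obtain ⟨x, k⟩ := p
    rw [Fintype.card_prod, Fintype.card_fin]
    rcases (from_of_reach hR h rfl).1 _ _ rfl with h | ⟨l, h⟩
    · simp only [Fin.val_zero, zero_mul] at h
      -- The excess 2r|C| already covers all r|C| critical darts.
      omega
    · have hlen := h.length
      have hsum := add_left_cancel h.sum
      simp only [Prod.smul_mk, Prod.mk.injEq, Fin.val_zero, zero_add] at hsum hlen
      -- Rigidity in each coordinate forces the same ports in every layer.
      have h₁ := hf (l.map Prod.fst) (g.fst k) (by simpa using hlen)
        (by rw [← hsum.1, List.map_map]; rfl)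
      have h₂ := hf (l.map Prod.snd) (g.snd k) (by simpa using hlen)
        (by rw [← hsum.2, List.map_map]; rfl)
      have hl : ∀ p ∈ l, p = (g.fst k, g.snd k) := fun p hp =>
        Prod.ext (h₁ _ (List.mem_map_of_mem hp)) (h₂ _ (List.mem_map_of_mem hp))
      have hc := Chain.count (i := 0) (x := x) hR k hl (by simpa using h)
      simp only [zero_mul, zero_add] at hc
      have hcard : (Finset.univ.filter fun c : Fin r × C =>
          R (Sum.inr (c.1, x + (c.1 : ℕ) • (f (g.fst k), f (g.snd k)) + (f (g.fst k), 0),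
              (g.crit k c.2).1))
            (Sum.inr (c.1, x + (c.1 : ℕ) • (f (g.fst k), f (g.snd k)) + (f (g.fst k), 0),
              (g.crit k c.2).2))).card =
          ∑ j ∈ Finset.Ico 0 r, (Finset.univ.filter fun c =>
            copyRel R j (x + j • (f (g.fst k), f (g.snd k)) + (f (g.fst k), 0))
              (g.crit k c).1 (g.crit k c).2).card := by
        rw [← Finset.range_eq_Ico, Finset.sum_range]
        simp only [Finset.card_filter, Fintype.sum_prod_type, copyRel, Fin.is_lt, exists_true_left,
          Fin.eta]
      rw [← hcard, add_comm t] at hc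
      exact le_trans (le_of_eq (by ring)) hc

end Gadget

/-! ### Rigid families from Behrend spheres -/

theorem IsRigid.comp {A B H : Type*} [AddCommGroup H] {r : ℕ} {f : A → H} (hf : IsRigid r f)
    {φ : B → A} (hφ : Function.Injective φ) : IsRigid r (f ∘ φ) := by
  intro l a hl hs b hb
  exact hφ (hf (l.map φ) (φ a) (by simpa using hl) (by simpa using hs) _ (List.mem_map_of_mem hb))

theorem List.sum_map_sum_sub_sq {d R : ℕ} {a : Fin d → ℕ} (ha : ∑ c, a c ^ 2 = R) :
    ∀ l : List (Fin d → ℕ), (∀ b ∈ l, ∑ c, b c ^ 2 = R) →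
      (l.map fun b => ∑ c, ((b c : ℤ) - a c) ^ 2).sum +
        2 * ∑ c, (a c : ℤ) * ((l.map fun b => b c).sum : ℕ) = 2 * R * l.length
  | [], _ => by simp
  | b :: l, hl => by
    have ih := List.sum_map_sum_sub_sq ha l fun b hb => hl b (by simp [hb])
    have hb : ∑ c, (b c : ℤ) ^ 2 = R := by exact_mod_cast hl b (by simp)
    have ha' : ∑ c, (a c : ℤ) ^ 2 = R := by exact_mod_cast ha
    have hexp : ∑ c, ((b c : ℤ) - a c) ^ 2 = R + R - 2 * ∑ c, (a c : ℤ) * b c := by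
      nth_rewrite 1 [← hb]
      rw [← ha', Finset.mul_sum, ← Finset.sum_add_distrib, ← Finset.sum_sub_distrib]
      exact Finset.sum_congr rfl fun c _ => by ring
    simp only [List.map_cons, List.sum_cons, Nat.cast_add, mul_add, Finset.sum_add_distrib,
      List.length_cons, Nat.cast_one]
    rw [hexp]
    linarith

/-- Coordinate sums of r points of the box are below rM, so the congruence is an equality of
integers. With Σb = ra and all norms equal, Σ|b - a|² = 2rR - 2⟨a, ra⟩ = 0. -/
theorem isRigid_sphere (d M R r : ℕ) :
    IsRigid r fun (v : Behrend.sphere d M R) (c : Fin d) => ((v.1 c : ℕ) : ZMod (r * M)) := by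
  intro l a hl hs b hb
  have hmem : ∀ v : Behrend.sphere d M R, (∀ c, v.1 c < M) ∧ ∑ c, v.1 c ^ 2 = R := by
    intro v
    have := Finset.mem_filter.1 v.2
    rwa [Behrend.mem_box] at this
  have hr : 0 < r := by
    rw [← hl]
    exact List.length_pos_of_mem hb
  have hsum : ∀ c, (l.map fun v => v.1 c).sum = r * a.1 c := by
    intro c
    have h := congrFun hs c
    simp only [Pi.smul_apply, nsmul_eq_mul] at h
    have hap : ∀ l : List (Behrend.sphere d M R),
        (l.map fun (v : Behrend.sphere d M R) (c : Fin d) => ((v.1 c : ℕ) : ZMod (r * M))).sum c =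
          (((l.map fun v => v.1 c).sum : ℕ) : ZMod (r * M)) := by
      intro l
      induction l with
      | nil => simp
      | cons v l ih =>
        rw [List.map_cons, List.sum_cons, Pi.add_apply, ih, List.map_cons, List.sum_cons,
          Nat.cast_add]
    rw [hap, ← Nat.cast_mul, ZMod.natCast_eq_natCast_iff] at h
    refine Nat.ModEq.eq_of_lt_of_lt h ?_ (Nat.mul_lt_mul_of_pos_left ((hmem a).1 c) hr)
    have hM : 0 < M := lt_of_le_of_lt (Nat.zero_le _) ((hmem a).1 c)
    have hle : (l.map fun v => v.1 c).sum ≤ (l.map fun v => v.1 c).length • (M - 1) := by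
      refine List.sum_le_card_nsmul _ _ fun x hx => ?_
      obtain ⟨v, -, rfl⟩ := List.mem_map.1 hx
      have := (hmem v).1 c
      omega
    rw [List.length_map, hl, smul_eq_mul] at hle
    exact hle.trans_lt (Nat.mul_lt_mul_of_pos_left (by omega) hr)
  have hsq := List.sum_map_sum_sub_sq (hmem a).2 (l.map Subtype.val) (by
    intro v hv
    obtain ⟨v, -, rfl⟩ := List.mem_map.1 hv
    exact (hmem v).2)
  simp only [List.map_map, Function.comp_def, hsum, List.length_map, hl] at hsq
  have ha : ∑ c, (a.1 c : ℤ) ^ 2 = R := by exact_mod_cast (hmem a).2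
  have hz : (l.map fun v => ∑ c, ((v.1 c : ℤ) - a.1 c) ^ 2).sum = 0 := by
    have : ∑ c, (a.1 c : ℤ) * ((r * a.1 c : ℕ) : ℤ) = r * R := by
      rw [← ha, Finset.mul_sum]
      exact Finset.sum_congr rfl fun c _ => by push_cast; ring
    rw [this] at hsq
    linarith
  have hb0 : ∑ c, ((b.1 c : ℤ) - a.1 c) ^ 2 = 0 := by
    refine le_antisymm ?_ (Finset.sum_nonneg fun c _ => sq_nonneg _)
    rw [← hz]
    refine List.single_le_sum (fun x hx => ?_) _
      (List.mem_map_of_mem (f := fun v => ∑ c, ((v.1 c : ℤ) - a.1 c) ^ 2) hb)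
    obtain ⟨v, -, rfl⟩ := List.mem_map.1 hx
    exact Finset.sum_nonneg fun c _ => sq_nonneg _
  refine Subtype.ext (funext fun c => ?_)
  have := (Finset.sum_eq_zero_iff_of_nonneg fun c _ => sq_nonneg _).1 hb0 c (Finset.mem_univ c)
  have := pow_eq_zero_iff (two_ne_zero) |>.1 this
  omega

/-- Some group of order `h` has an `r`-rigid family of `a` elements. -/
def HasRigid (r a h : ℕ) : Prop :=
  ∃ (H : Type) (_ : AddCommGroup H) (_ : Fintype H) (f : Fin a → H),
    IsRigid r f ∧ Fintype.card H = h

theorem HasRigid.le {r a h : ℕ} (hr : 0 < r) (H : HasRigid r a h) : a ≤ h := by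
  obtain ⟨H, _, _, f, hf, rfl⟩ := H
  simpa using Fintype.card_le_of_injective f fun x y hxy =>
    hf.smul_injective hr (by rw [hxy])

theorem hasRigid_one (r : ℕ) {h : ℕ} (hh : 0 < h) : HasRigid r 1 h := by
  have : NeZero h := ⟨hh.ne'⟩
  exact ⟨ZMod h, inferInstance, inferInstance, fun _ => 0,
    fun _ _ _ _ _ _ => Subsingleton.elim _ _, ZMod.card h⟩

/-- In dimension d = D + 2 some sphere has at least M^D/d points, so M of order (da)^(1/D) suffices.
The group has order (rM)^d, and d/D = 1 + 2/D ≤ 1 + γ. -/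
theorem exists_hasRigid {γ : ℝ} (hγ : 0 < γ) : ∃ Q : ℝ, 1 ≤ Q ∧ ∃ K : ℕ, ∀ r a : ℕ, 0 < r → 0 < a →
    ∃ h, HasRigid r a h ∧ (h : ℝ) ≤ (Q * r) ^ K * (a : ℝ) ^ (1 + γ) := by
  set D := ⌈2 / γ⌉₊ + 1 with hD
  have hD0 : (0 : ℝ) < D := by positivity
  have hDγ : 2 / γ ≤ D := (Nat.le_ceil _).trans (by rw [hD]; push_cast; linarith)
  set d := D + 2 with hd
  have hd1 : (1 : ℝ) ≤ d := by rw [hd]; push_cast; linarith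
  have hdp : (1 : ℝ) ≤ (d : ℝ) ^ (1 + γ) := Real.one_le_rpow hd1 (by linarith)
  refine ⟨2 * (d : ℝ) ^ (1 + γ), by linarith, d, fun r a hr ha => ?_⟩
  have ha1 : (1 : ℝ) ≤ a := by exact_mod_cast ha
  have hda : (1 : ℝ) ≤ d * a := by nlinarith
  set y : ℝ := (d * a : ℝ) ^ (1 / (D : ℝ)) with hy
  have hy1 : 1 ≤ y := Real.one_le_rpow hda (by positivity)
  set M := ⌈y⌉₊ with hM
  have hM1 : y ≤ M := Nat.le_ceil _
  have hM2 : (M : ℝ) ≤ 2 * y := by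
    have := Nat.ceil_lt_add_one (by linarith : 0 ≤ y)
    linarith
  have hM0 : 0 < M := Nat.ceil_pos.2 (by linarith)
  have hMr : (0 : ℝ) < M := by exact_mod_cast hM0
  have hyD : y ^ D = d * a := by
    rw [hy, ← Real.rpow_natCast, ← Real.rpow_mul (by positivity), one_div_mul_cancel hD0.ne',
      Real.rpow_one]
  obtain ⟨k, hk⟩ := Behrend.exists_large_sphere d M
  have hcard : a ≤ (Behrend.sphere d M k).card := by
    have h1 : (a : ℝ) ≤ ((Behrend.sphere d M k).card : ℝ) := by
      refine le_trans ?_ hk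
      rw [le_div_iff₀ (by positivity)]
      have : y ^ D ≤ (M : ℝ) ^ D := by gcongr
      rw [hyD] at this
      push_cast
      rw [hd, pow_add, ← hd]
      nlinarith [sq_nonneg (M : ℝ)]
    exact_mod_cast h1
  have : NeZero (r * M) := ⟨(Nat.mul_pos hr hM0).ne'⟩
  obtain ⟨φ⟩ : Nonempty (Fin a ↪ Behrend.sphere d M k) :=
    Function.Embedding.nonempty_of_card_le (by simpa using hcard)
  refine ⟨(r * M) ^ d, ⟨Fin d → ZMod (r * M), inferInstance, inferInstance, _,
    (isRigid_sphere d M k r).comp φ.injective, by simp [ZMod.card]⟩, ?_⟩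
  have hr0 : (0 : ℝ) < r := by exact_mod_cast hr
  have hyd : y ^ d ≤ (d : ℝ) ^ (1 + γ) * (a : ℝ) ^ (1 + γ) := by
    rw [← Real.mul_rpow (by positivity) (by positivity), hy, ← Real.rpow_natCast,
      ← Real.rpow_mul (by positivity)]
    refine Real.rpow_le_rpow_of_exponent_le hda ?_
    rw [hd]
    push_cast
    rw [one_div, inv_mul_le_iff₀ hD0]
    rw [div_le_iff₀ hγ] at hDγ
    linarith
  calc (((r * M) ^ d : ℕ) : ℝ) = (r : ℝ) ^ d * (M : ℝ) ^ d := by push_cast; ring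
    _ ≤ (r : ℝ) ^ d * (2 * y) ^ d := by gcongr
    _ = (2 * r : ℝ) ^ d * y ^ d := by rw [mul_pow, mul_pow]; ring
    _ ≤ (2 * r : ℝ) ^ d * ((d : ℝ) ^ (1 + γ) * (a : ℝ) ^ (1 + γ)) := by gcongr
    _ ≤ (2 * r : ℝ) ^ d * (((d : ℝ) ^ (1 + γ)) ^ d * (a : ℝ) ^ (1 + γ)) := by
        gcongr
        exact le_self_pow₀ hdp (by omega)
    _ = (2 * (d : ℝ) ^ (1 + γ) * r) ^ d * (a : ℝ) ^ (1 + γ) := by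
        rw [mul_pow, mul_pow, mul_pow]; ring

/-! ### Gadget sizes and the resulting spanner bound -/

/-- Some gadget has `m` critical darts for each pair, length `len`, and `nA` ports, `nI` pairs and
`nV` vertices. -/
def HasGadget (m len nA nI nV : ℕ) : Prop :=
  ∃ (A V I C : Type) (_ : Fintype A) (_ : Fintype V) (_ : Fintype I) (_ : Fintype C)
    (g : Gadget A V I C), Fintype.card C = m ∧ g.len = len ∧ Fintype.card A = nA ∧
      Fintype.card I = nI ∧ Fintype.card V = nV

theorem hasGadget_bipartite (a : ℕ) : HasGadget 1 1 a (a * a) (a + a) :=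
  ⟨Fin a, _, _, _, inferInstance, inferInstance, inferInstance, inferInstance,
    Gadget.bipartite (Fin a), by simp [Gadget.bipartite]⟩

theorem HasGadget.prod {m len nA nI nV r h : ℕ} (hg : HasGadget m len nA nI nV) (hm : 0 < m)
    (hr : 0 < r) (hh : HasRigid r nA h) :
    HasGadget (r * m) (r * (2 * (r * m) + len)) (h * h) (h * h * nI)
      ((r + 1) * (h * h) + r * (h * h * nV)) := by
  obtain ⟨A, V, I, C, _, _, _, _, g, rfl, rfl, rfl, rfl, rfl⟩ := hg
  obtain ⟨H, _, _, f, hf, rfl⟩ := hh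
  have : Nonempty C := Fintype.card_pos_iff.1 hm
  refine ⟨_, _, _, _, inferInstance, inferInstance, inferInstance, inferInstance,
    g.prod (f ∘ Fintype.equivFin A) r hr (hf.comp (Fintype.equivFin A).injective), ?_⟩
  simp [Gadget.prod, Gadget.layerLen]

theorem HasGadget.le {m len nA nI nV : ℕ} (hg : HasGadget m len nA nI nV) : nA ≤ nV := by
  obtain ⟨A, V, I, C, _, _, _, _, g, rfl, rfl, rfl, rfl, rfl⟩ := hg
  exact Fintype.card_le_of_injective _ g.src_injective

namespace Gadget

variable {A V I C : Type} [Fintype C] {n : ℕ}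

/-- The weighted graph of a gadget, placed on a larger vertex set. -/
noncomputable def toWeightedGraph [Nonempty V] (g : Gadget A V I C) (e : V ↪ Fin n) :
    WeightedGraph (Fin n) where
  graph := SimpleGraph.map e ⟨g.Adj, ⟨g.symm⟩, ⟨g.irrefl⟩⟩
  weight := Sym2.lift ⟨fun x y => (g.wt (Function.invFun e x) (Function.invFun e y) : ℝ≥0),
    fun _ _ => congrArg _ (g.wt_symm _ _)⟩
  weight_pos := by
    intro x _
    induction x with
    | _ x y => simpa using g.wt_pos _ _

variable [Nonempty V] (g : Gadget A V I C) (e : V ↪ Fin n)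

theorem toWeightedGraph_weight (u v : V) :
    (g.toWeightedGraph e).weight s(e u, e v) = g.wt u v := by
  simp [toWeightedGraph, Function.leftInverse_invFun e.injective _]

theorem toWeightedGraph_adj {x y : Fin n} :
    (g.toWeightedGraph e).graph.Adj x y ↔ ∃ u v, g.Adj u v ∧ e u = x ∧ e v = y :=
  SimpleGraph.map_adj _ _ _ _

theorem exists_walk {u v : V} {t : ℕ} (h : WReach g.wt g.Adj u v t) :
    ∃ q : (g.toWeightedGraph e).graph.Walk (e u) (e v),
      walkWeight (g.toWeightedGraph e).weight q = t := by
  induction h with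
  | nil u => exact ⟨SimpleGraph.Walk.nil, by simp [walkWeight]⟩
  | @cons u v _ t h _ ih =>
    obtain ⟨q, hq⟩ := ih
    refine ⟨SimpleGraph.Walk.cons ((g.toWeightedGraph_adj e).2 ⟨u, v, h, rfl, rfl⟩) q, ?_⟩
    rw [walkWeight] at hq
    rw [walkWeight, SimpleGraph.Walk.edges_cons, List.map_cons, List.sum_cons, hq,
      toWeightedGraph_weight, Nat.cast_add]

theorem exists_reach {S : SimpleGraph (Fin n)} (hS : S ≤ (g.toWeightedGraph e).graph)
    {x y : Fin n} (q : S.Walk x y) : ∀ u v, x = e u → y = e v →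
      ∃ t : ℕ, WReach g.wt (fun u v => S.Adj (e u) (e v)) u v t ∧
        walkWeight (g.toWeightedGraph e).weight q = t := by
  induction q with
  | nil =>
    intro u v hu hv
    obtain rfl := e.injective (hu.symm.trans hv)
    exact ⟨0, WReach.nil _, by simp [walkWeight]⟩
  | @cons x y z h q ih =>
    rintro u v rfl hv
    obtain ⟨_, u', _, _, rfl⟩ := (g.toWeightedGraph_adj e).1 (hS h)
    obtain ⟨t, ht, hq⟩ := ih u' v rfl hv
    refine ⟨g.wt u u' + t, WReach.cons h ht, ?_⟩
    rw [walkWeight] at hq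
    rw [walkWeight, SimpleGraph.Walk.edges_cons, List.map_cons, List.sum_cons, hq,
      toWeightedGraph_weight, Nat.cast_add]

end Gadget

theorem HasGadget.exists_spanner_bound {m len nA nI nV n : ℕ} (hg : HasGadget m len nA nI nV)
    (hV : 0 < nV) (hn : nV ≤ n) (hlen : 0 < len) {ε : ℝ} (hε : 0 < ε)
    (hεm : ε * len ≤ m / 2) :
    ∃ (G : WeightedGraph (Fin n)) (P : Finset (Fin n × Fin n)), P.card = nI ∧
      ∀ S : SimpleGraph (Fin n), IsPairwiseSpanner G P (1 + ε) S →
        m * nI ≤ 4 * S.edgeSet.ncard := by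
  classical
  obtain ⟨A, V, I, C, _, _, _, _, g, rfl, rfl, rfl, rfl, rfl⟩ := hg
  have : Nonempty V := Fintype.card_pos_iff.1 hV
  obtain ⟨e⟩ : Nonempty (V ↪ Fin n) := Function.Embedding.nonempty_of_card_le (by simpa using hn)
  refine ⟨g.toWeightedGraph e,
    Finset.univ.image fun i => (e (g.src (g.fst i)), e (g.tgt (g.snd i))), ?_, ?_⟩
  · rw [Finset.card_image_of_injective, Finset.card_univ]
    intro i j hij
    simp only [Prod.mk.injEq, EmbeddingLike.apply_eq_iff_eq] at hij
    exact g.ends_injective (Prod.ext (g.src_injective hij.1) (g.tgt_injective hij.2))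
  · rintro S ⟨hS, hP⟩
    have hcount : ∀ i, Fintype.card C ≤ 2 * (Finset.univ.filter fun c =>
        S.Adj (e (g.crit i c).1) (e (g.crit i c).2)).card := by
      intro i
      have h := hP _ (Finset.mem_image_of_mem _ (Finset.mem_univ i))
      obtain ⟨q₀, hq₀⟩ := g.exists_walk e (g.reach i)
      have hG : weightedDist (g.toWeightedGraph e).graph (g.toWeightedGraph e).weight
          (e (g.src (g.fst i))) (e (g.tgt (g.snd i))) ≤ ENNReal.ofReal g.len := by
        refine (iInf_le _ q₀).trans ?_
        rw [hq₀]
        simp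
      -- Doubling ε makes the inequality strict, so an actual walk can be taken from the infimum;
      -- its excess is still below |C|.
      have hlt : weightedDist S (g.toWeightedGraph e).weight
          (e (g.src (g.fst i))) (e (g.tgt (g.snd i))) < ENNReal.ofReal ((1 + 2 * ε) * g.len) := by
        refine (h.trans (mul_le_mul_right hG _)).trans_lt ?_
        rw [← ENNReal.ofReal_mul (by linarith)]
        have : (0 : ℝ) < g.len := by exact_mod_cast hlen
        exact (ENNReal.ofReal_lt_ofReal_iff (by positivity)).2 (by nlinarith)
      obtain ⟨q, hq⟩ := iInf_lt_iff.1 hlt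
      obtain ⟨t, ht, hqt⟩ := g.exists_reach e hS q _ _ rfl rfl
      rw [hqt] at hq
      have hq' : (t : ℝ) < (1 + 2 * ε) * g.len := by
        have : ENNReal.ofReal (t : ℝ) < ENNReal.ofReal ((1 + 2 * ε) * g.len) := by simpa using hq
        exact (ENNReal.ofReal_lt_ofReal_iff_of_nonneg (by positivity)).1 this
      have hrob := g.robust _ (fun u v huv => by
        obtain ⟨u', v', h', hu, hv⟩ := (g.toWeightedGraph_adj e).1 (hS huv)
        rwa [← e.injective hu, ← e.injective hv]) i t ht
      have hrob' : (2 * Fintype.card C + g.len : ℝ) ≤ 2 * (Finset.univ.filter fun c =>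
        S.Adj (e (g.crit i c).1) (e (g.crit i c).2)).card + t := by
        convert (Nat.cast_le (α := ℝ)).2 hrob using 1 <;> push_cast <;> rfl
      have : (Fintype.card C : ℝ) ≤ 2 * (Finset.univ.filter fun c =>
        S.Adj (e (g.crit i c).1) (e (g.crit i c).2)).card := by linarith
      exact_mod_cast this
    have hdart : (Finset.univ.filter fun p : I × C =>
        S.Adj (e (g.crit p.1 p.2).1) (e (g.crit p.1 p.2).2)).card ≤ Fintype.card S.Dart := by
      rw [← Fintype.card_coe]
      refine Fintype.card_le_of_injective
        (fun p => ⟨(e (g.crit p.1.1 p.1.2).1, e (g.crit p.1.1 p.1.2).2),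
          (Finset.mem_filter.1 p.2).2⟩) fun p p' h => ?_
      have := congrArg SimpleGraph.Dart.toProd h
      simp only [Prod.mk.injEq, EmbeddingLike.apply_eq_iff_eq] at this
      exact Subtype.ext (g.crit_injective (Prod.ext this.1 this.2))
    -- Darts count edges twice; with half of the critical darts present, this gives the factor 4.
    rw [SimpleGraph.dart_card_eq_twice_card_edges] at hdart
    rw [Set.ncard_eq_toFinset_card', ← SimpleGraph.edgeFinset]
    have hsum : (Finset.univ.filter fun p : I × C =>
        S.Adj (e (g.crit p.1 p.2).1) (e (g.crit p.1 p.2).2)).card =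
        ∑ i, (Finset.univ.filter fun c =>
          S.Adj (e (g.crit i c).1) (e (g.crit i c).2)).card := by
      simp only [Finset.card_filter, Fintype.sum_prod_type]
    have h := Finset.sum_le_sum fun i (_ : i ∈ Finset.univ) => hcount i
    rw [← Finset.mul_sum, ← hsum, Finset.sum_const, Finset.card_univ, smul_eq_mul] at h
    nlinarith

/-! ### Iterating the product -/

theorem HasGadget.prod_pow {κ nA nI nV r h : ℕ}
    (hg : HasGadget (r ^ κ) (r ^ κ * (1 + 2 * κ * r)) nA nI nV) (hr : 0 < r)
    (hh : HasRigid r nA h) :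
    HasGadget (r ^ (κ + 1)) (r ^ (κ + 1) * (1 + 2 * (κ + 1 : ℕ) * r)) (h * h) (h * h * nI)
      ((r + 1) * (h * h) + r * (h * h * nV)) := by
  convert hg.prod (pow_pos hr κ) hr hh using 1
  · ring
  · ring

theorem card_vertices_prod_le {r s v : ℕ} (hr : 0 < r) (hv : 0 < v) :
    (r + 1) * s + r * (s * v) ≤ 3 * r * (s * v) := by
  have h1 : s ≤ s * v := Nat.le_mul_of_pos_right _ hv
  have h2 : r * s ≤ r * (s * v) := Nat.mul_le_mul_left _ h1
  have h3 : s * v ≤ r * (s * v) := Nat.le_mul_of_pos_left _ hr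
  nlinarith

/-- T absorbs the factor 3r and the loss in the rigid family, while its exponent h depends on γ and
κ only, so T^h is negligible for fixed κ. Each product squares the number of ports, up to the
exponent 1 + γ. -/
theorem exists_hasGadget {γ : ℝ} (hγ : 0 ≤ γ) (κ : ℕ) : ∃ h : ℝ, 0 ≤ h ∧
    ∀ (r a : ℕ) (T : ℝ), 0 < r → 0 < a → 3 * (r : ℝ) ≤ T →
      (∀ b : ℕ, 0 < b → ∃ c : ℕ, HasRigid r b c ∧ (c : ℝ) ≤ T * (b : ℝ) ^ (1 + γ)) →
      ∃ nA nI nV : ℕ, HasGadget (r ^ κ) (r ^ κ * (1 + 2 * κ * r)) nA nI nV ∧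
        a ^ 2 ^ κ ≤ nA ∧ (nA : ℝ) ≤ T ^ h * (a : ℝ) ^ ((2 * (1 + γ)) ^ κ) ∧
        a ^ 2 ^ (κ + 1) ≤ nI ∧
        (nV : ℝ) ≤ T ^ h * (a : ℝ) ^ (∑ j ∈ Finset.range (κ + 1), (2 * (1 + γ)) ^ j) := by
  induction κ with
  | zero =>
    refine ⟨1, zero_le_one, fun r a T hr ha hT _ => ⟨a, a * a, a + a, ?_, ?_, ?_, ?_, ?_⟩⟩
    · simpa using hasGadget_bipartite a
    · simp
    · have h1 : (1 : ℝ) ≤ r := by exact_mod_cast hr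
      have h2 : (0 : ℝ) < a := by exact_mod_cast ha
      simp only [Real.rpow_one, pow_zero]
      nlinarith
    · simp [pow_two]
    · have h1 : (1 : ℝ) ≤ r := by exact_mod_cast hr
      have h2 : (0 : ℝ) < a := by exact_mod_cast ha
      simp only [Real.rpow_one, zero_add, Finset.range_one, Finset.sum_singleton, pow_zero]
      push_cast
      nlinarith
  | succ κ ih =>
    obtain ⟨h, hh, ih⟩ := ih
    refine ⟨3 + 2 * (1 + γ) * h + h, by positivity, fun r a T hr ha hT hrig => ?_⟩
    obtain ⟨nA, nI, nV, hg, hA, hA', hI, hV⟩ := ih r a T hr ha hT hrig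
    have hA0 : 0 < nA := lt_of_lt_of_le (pow_pos ha _) hA
    have hV0 : 0 < nV := lt_of_lt_of_le hA0 hg.le
    obtain ⟨c, hc, hcT⟩ := hrig nA hA0
    have hr1 : (1 : ℝ) ≤ r := by exact_mod_cast hr
    have hT1 : 1 ≤ T := by linarith
    have hT0 : 0 < T := by linarith
    have ha0 : (0 : ℝ) < a := by exact_mod_cast ha
    have hAc := hc.le hr
    have hsq : a ^ 2 ^ (κ + 1) ≤ c * c := by
      rw [pow_succ 2, pow_mul, pow_two]
      exact Nat.mul_le_mul (hA.trans hAc) (hA.trans hAc)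
    have hcc : (c : ℝ) * c ≤
        T ^ (2 + 2 * (1 + γ) * h) * (a : ℝ) ^ ((2 * (1 + γ)) ^ (κ + 1)) := by
      have h1 : (nA : ℝ) ^ (1 + γ) ≤
          T ^ (h * (1 + γ)) * (a : ℝ) ^ ((2 * (1 + γ)) ^ κ * (1 + γ)) := by
        rw [Real.rpow_mul hT0.le, Real.rpow_mul ha0.le,
          ← Real.mul_rpow (by positivity) (by positivity)]
        exact Real.rpow_le_rpow (by positivity) hA' (by linarith)
      have h2 : (c : ℝ) ≤ T * (T ^ (h * (1 + γ)) * (a : ℝ) ^ ((2 * (1 + γ)) ^ κ * (1 + γ))) :=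
        hcT.trans (by gcongr)
      calc (c : ℝ) * c ≤ (T * (T ^ (h * (1 + γ)) * (a : ℝ) ^ ((2 * (1 + γ)) ^ κ * (1 + γ)))) *
            (T * (T ^ (h * (1 + γ)) * (a : ℝ) ^ ((2 * (1 + γ)) ^ κ * (1 + γ)))) := by gcongr
        _ = T ^ (2 + 2 * (1 + γ) * h) * (a : ℝ) ^ ((2 * (1 + γ)) ^ (κ + 1)) := by
          have e1 : 2 + 2 * (1 + γ) * h = 1 + 1 + (h * (1 + γ) + h * (1 + γ)) := by ring
          have e2 : (2 * (1 + γ)) ^ (κ + 1) =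
            (2 * (1 + γ)) ^ κ * (1 + γ) + (2 * (1 + γ)) ^ κ * (1 + γ) := by ring
          rw [e1, e2, Real.rpow_add hT0, Real.rpow_add hT0, Real.rpow_add hT0, Real.rpow_one,
            Real.rpow_add ha0]
          ring
    refine ⟨_, _, _, hg.prod_pow hr hc, hsq, ?_, ?_, ?_⟩
    · push_cast
      refine hcc.trans (mul_le_mul_of_nonneg_right
        (Real.rpow_le_rpow_of_exponent_le hT1 ?_) (by positivity))
      linarith
    · rw [pow_succ 2 (κ + 1), pow_mul, pow_two]
      exact Nat.mul_le_mul hsq hI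
    · have h1 : (((r + 1) * (c * c) + r * (c * c * nV) : ℕ) : ℝ) ≤ 3 * r * (c * c * nV) := by
        exact_mod_cast card_vertices_prod_le hr hV0
      refine h1.trans ?_
      calc 3 * (r : ℝ) * (c * c * nV) ≤ T * ((T ^ (2 + 2 * (1 + γ) * h) *
            (a : ℝ) ^ ((2 * (1 + γ)) ^ (κ + 1))) *
            (T ^ h * (a : ℝ) ^ (∑ j ∈ Finset.range (κ + 1), (2 * (1 + γ)) ^ j))) := by gcongr
        _ = _ := by
          have e1 : 3 + 2 * (1 + γ) * h + h = 1 + (2 + 2 * (1 + γ) * h) + h := by ring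
          rw [e1, Finset.sum_range_succ _ (κ + 1), Real.rpow_add hT0 (1 + _) h,
            Real.rpow_add hT0 1, Real.rpow_one, Real.rpow_add ha0]
          ring

theorem exists_hasGadget_one {r : ℕ} (hr : 0 < r) (κ : ℕ) :
    ∃ nV : ℕ, HasGadget (r ^ κ) (r ^ κ * (1 + 2 * κ * r)) 1 1 nV ∧ nV ≤ 2 * (3 * r) ^ κ := by
  induction κ with
  | zero => exact ⟨2, by simpa using hasGadget_bipartite 1, by simp⟩
  | succ κ ih =>
    obtain ⟨nV, hg, hV⟩ := ih
    refine ⟨_, hg.prod_pow hr (hasRigid_one r one_pos), ?_⟩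
    refine (card_vertices_prod_le hr (lt_of_lt_of_le one_pos hg.le)).trans ?_
    rw [pow_succ]
    nlinarith

/-- With a single port any group will do: in the last product each of the h² positions carries its
own copy of the one-pair gadget. -/
theorem exists_hasGadget_copies {r h : ℕ} (hr : 0 < r) (hh : 0 < h) (κ : ℕ) :
    ∃ nV : ℕ, HasGadget (r ^ (κ + 1)) (r ^ (κ + 1) * (1 + 2 * (κ + 1 : ℕ) * r)) (h * h) (h * h) nV ∧
      nV ≤ h * h * (2 * (3 * r) ^ (κ + 1)) := by
  obtain ⟨nV, hg, hV⟩ := exists_hasGadget_one hr κ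
  refine ⟨_, by simpa using hg.prod_pow hr (hasRigid_one r hh), ?_⟩
  refine (card_vertices_prod_le hr (lt_of_lt_of_le one_pos hg.le)).trans ?_
  calc 3 * r * (h * h * nV) ≤ 3 * r * (h * h * (2 * (3 * r) ^ κ)) := by gcongr
    _ = _ := by ring

/-! ### Choice of parameters -/

/-- For every `n` and every admissible `ε` there is a gadget with `κ` levels that has at most `n`
vertices and sufficiently many pairs. -/
def HasDenseGadgets (η θ : ℝ) (κ : ℕ) : Prop :=
  ∀ (n : ℕ) (ε : ℝ), 0 < ε → ε < 1 / (12 * (κ : ℝ)) →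
    (κ : ℝ) ^ 2 * Real.log (1 / ε) ≤ θ * Real.log (n : ℝ) →
      ∃ nA nI nV : ℕ, HasGadget (⌊1 / (6 * ε * κ)⌋₊ ^ κ)
          (⌊1 / (6 * ε * κ)⌋₊ ^ κ * (1 + 2 * κ * ⌊1 / (6 * ε * κ)⌋₊)) nA nI nV ∧
        0 < nV ∧ nV ≤ n ∧ (n : ℝ) ^ ((1 : ℝ) + 1 / ((2 : ℝ) ^ (κ + 1) - 1) - η) ≤ nI

theorem HasDenseGadgets.mono {η θ θ' : ℝ} {κ : ℕ} (h : HasDenseGadgets η θ κ) (hθ : θ' ≤ θ) :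
    HasDenseGadgets η θ' κ := fun n ε h₀ h₁ h₂ =>
  h n ε h₀ h₁ (h₂.trans (mul_le_mul_of_nonneg_right hθ (Real.log_natCast_nonneg n)))

section Parameters

variable {κ : ℕ} {ε : ℝ}

theorem floor_bounds (hκ : 1 < κ) (hε : 0 < ε) (hε' : ε < 1 / (12 * (κ : ℝ))) :
    0 < ⌊1 / (6 * ε * κ)⌋₊ ∧ 1 / (12 * ε * κ) ≤ (⌊1 / (6 * ε * κ)⌋₊ : ℝ) ∧
      6 * ε * κ * (⌊1 / (6 * ε * κ)⌋₊ : ℝ) ≤ 1 := by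
  have hκ0 : (0 : ℝ) < κ := by exact_mod_cast (by omega : 0 < κ)
  have hp : 0 < ε * κ := by positivity
  have h2 : (2 : ℝ) ≤ 1 / (6 * ε * κ) := by
    rw [lt_div_iff₀ (by positivity)] at hε'
    rw [le_div_iff₀ (by positivity)]
    linarith
  have h3 := Nat.lt_floor_add_one (1 / (6 * ε * κ))
  have h4 := Nat.floor_le (by linarith : 0 ≤ 1 / (6 * ε * κ))
  have h5 : 1 / (12 * ε * κ) = 1 / (6 * ε * κ) / 2 := by field_simp; norm_num
  refine ⟨Nat.floor_pos.2 (by linarith), by rw [h5]; linarith, ?_⟩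
  rw [le_div_iff₀ (by positivity)] at h4
  linarith

theorem one_lt_log_inv (hκ : 1 < κ) (hε : 0 < ε) (hε' : ε < 1 / (12 * (κ : ℝ))) :
    Real.log 8 ≤ Real.log (1 / ε) ∧ 1 ≤ Real.log (1 / ε) := by
  have hκ2 : (2 : ℝ) ≤ κ := by exact_mod_cast hκ
  have h8 : (8 : ℝ) ≤ 1 / ε := by
    rw [lt_div_iff₀ (by positivity)] at hε'
    rw [le_div_iff₀ hε]
    nlinarith
  have h := Real.log_le_log (by norm_num) h8
  refine ⟨h, le_trans ?_ h⟩
  rw [Real.le_log_iff_exp_le (by norm_num)]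
  linarith [Real.exp_one_lt_d9]

theorem three_mul_floor_le (hκ : 1 < κ) (hε : 0 < ε) (hε' : ε < 1 / (12 * (κ : ℝ))) :
    3 * (⌊1 / (6 * ε * κ)⌋₊ : ℝ) ≤ 1 / ε := by
  have hκ2 : (2 : ℝ) ≤ κ := by exact_mod_cast hκ
  obtain ⟨-, -, h⟩ := floor_bounds hκ hε hε'
  rw [le_div_iff₀ hε]
  have : 0 ≤ ε * (⌊1 / (6 * ε * κ)⌋₊ : ℝ) := by positivity
  nlinarith

end Parameters

/-- Here n^(1-η/2) pairs are enough, and copies of the one-pair gadget supply them: its size is at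
most 2(3r)^κ, and (κ + 1) log(1/ε) ≤ κ² log(1/ε) makes this a small power of n with θ independent of
κ. -/
theorem hasDenseGadgets_of_large {η : ℝ} {κ : ℕ} (hκ : 1 < κ)
    (hκη : 1 / ((2 : ℝ) ^ (κ + 1) - 1) ≤ η / 2) : HasDenseGadgets η (min (η / 2) 1) κ := by
  intro n ε hε hε' hθ
  obtain ⟨hr, -, -⟩ := floor_bounds hκ hε hε'
  obtain ⟨h8, hΛ⟩ := one_lt_log_inv hκ hε hε'
  have h3r := three_mul_floor_le hκ hε hε'
  set r := ⌊1 / (6 * ε * κ)⌋₊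
  have hκ2 : (2 : ℝ) ≤ κ := by exact_mod_cast hκ
  have hr0 : (0 : ℝ) < r := by exact_mod_cast hr
  have hn : 0 < n := by
    rcases Nat.eq_zero_or_pos n with rfl | h
    · simp only [Nat.cast_zero, Real.log_zero, mul_zero] at hθ
      nlinarith
    · exact h
  have hn1 : (1 : ℝ) ≤ n := by exact_mod_cast hn
  have hn0 : (0 : ℝ) < n := by linarith
  set x := (3 * r) ^ κ with hx
  have hx0 : 0 < x := by positivity
  have hx0' : (0 : ℝ) < x := by exact_mod_cast hx0
  have hlog : Real.log (8 * x) ≤ min (η / 2) 1 * Real.log n := by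
    refine le_trans ?_ hθ
    rw [Real.log_mul (by norm_num) hx0'.ne', hx]
    push_cast
    rw [Real.log_pow]
    have : Real.log (3 * r) ≤ Real.log (1 / ε) := Real.log_le_log (by positivity) h3r
    have h1 : (κ : ℝ) * Real.log (3 * r) ≤ κ * Real.log (1 / ε) := by gcongr
    have h2 : ((κ : ℝ) + 1) * Real.log (1 / ε) ≤ (κ : ℝ) ^ 2 * Real.log (1 / ε) := by
      gcongr
      nlinarith
    linarith
  have hxn : (8 * x : ℝ) ≤ (n : ℝ) ^ min (η / 2) 1 := by
    rw [← Real.log_le_log_iff (by positivity) (by positivity), Real.log_rpow hn0]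
    exact hlog
  have hxη : (8 * x : ℝ) ≤ (n : ℝ) ^ (η / 2) :=
    hxn.trans (Real.rpow_le_rpow_of_exponent_le hn1 (min_le_left _ _))
  have hx1 : 8 * x ≤ n := by
    have := hxn.trans (Real.rpow_le_rpow_of_exponent_le hn1 (min_le_right _ _))
    rw [Real.rpow_one] at this
    exact_mod_cast this
  set h := Nat.sqrt (n / (2 * x)) with hh
  have hh0 : 0 < h := Nat.sqrt_pos.2 (Nat.div_pos (by omega) (by omega))
  obtain ⟨k, rfl⟩ : ∃ k, κ = k + 1 := ⟨κ - 1, by omega⟩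
  obtain ⟨nV, hg, hV⟩ := exists_hasGadget_copies hr hh0 k
  refine ⟨_, _, nV, hg, lt_of_lt_of_le (Nat.mul_pos hh0 hh0) hg.le, hV.trans ?_, ?_⟩
  · exact (Nat.mul_le_mul_right _ (Nat.sqrt_le _)).trans (Nat.div_mul_le_self _ _)
  · have hlt : n < 2 * x * ((h + 1) * (h + 1)) := by
      rw [mul_comm, ← Nat.div_lt_iff_lt_mul (by omega)]
      exact Nat.lt_succ_sqrt _
    have hle : n ≤ 8 * x * (h * h) := by
      refine hlt.le.trans ?_
      have : (h + 1) * (h + 1) ≤ 4 * (h * h) := by nlinarith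
      nlinarith
    have hle' : (n : ℝ) ≤ 8 * x * (h * h : ℕ) := by exact_mod_cast hle
    have hpow : (n : ℝ) ^ (1 - η / 2) ≤ (h * h : ℕ) := by
      rw [Real.rpow_sub hn0, Real.rpow_one, div_le_iff₀ (by positivity)]
      refine hle'.trans ?_
      rw [mul_comm]
      gcongr
    exact (Real.rpow_le_rpow_of_exponent_le hn1 (by linarith)).trans hpow

theorem scale_rpow_le {Q h δ ε : ℝ} {K r n : ℕ} (hQ : 1 ≤ Q) (hr : 0 < r) (hh : 0 ≤ h)
    (hn : (0 : ℝ) < n) (h3r : 3 * (r : ℝ) ≤ 1 / ε) (hΛ : 1 ≤ Real.log (1 / ε))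
    (hδ : h * ((K + 1) * (Real.log Q + 1)) * Real.log (1 / ε) ≤ δ * Real.log n) :
    ((3 * Q * r) ^ (K + 1)) ^ h ≤ (n : ℝ) ^ δ := by
  have hr0 : (0 : ℝ) < r := by exact_mod_cast hr
  have hlogQ : 0 ≤ Real.log Q := Real.log_nonneg hQ
  have hT0 : 0 < (3 * Q * r) ^ (K + 1) := by positivity
  rw [← Real.log_le_log_iff (by positivity) (by positivity), Real.log_rpow hT0,
    Real.log_rpow hn, Real.log_pow]
  refine le_trans ?_ hδ
  have h1 : Real.log (3 * Q * r) ≤ (Real.log Q + 1) * Real.log (1 / ε) := by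
    have e : 3 * Q * (r : ℝ) = Q * (3 * r) := by ring
    rw [e, Real.log_mul (by positivity) (by positivity)]
    have h2 : Real.log (3 * r) ≤ Real.log (1 / ε) := Real.log_le_log (by positivity) h3r
    have h3 : Real.log Q ≤ Real.log Q * Real.log (1 / ε) := le_mul_of_one_le_right hlogQ hΛ
    linarith
  calc h * (((K + 1 : ℕ) : ℝ) * Real.log (3 * Q * r))
      ≤ h * (((K + 1 : ℕ) : ℝ) * ((Real.log Q + 1) * Real.log (1 / ε))) := by gcongr
    _ = h * ((K + 1) * (Real.log Q + 1)) * Real.log (1 / ε) := by push_cast; ring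

theorem rpow_le_of_rpow_le {n E y η η' a N : ℝ} (hn : 1 ≤ n) (hyE : y * (E + 1) = 1 + 1 / E - η' / 2)
    (hη : η' ≤ η) (h2 : (2 : ℝ) ^ (E + 1) ≤ n ^ (η' / 2)) (hna : n ^ y ≤ 2 * a)
    (hE : 0 ≤ E + 1) (haN : a ^ (E + 1) ≤ N) : n ^ (1 + 1 / E - η) ≤ N := by
  have hn0 : 0 < n := by linarith
  have hny : 0 < n ^ y := Real.rpow_pos_of_pos hn0 y
  have ha : 0 ≤ a := by linarith
  have hN : 0 ≤ N := (Real.rpow_nonneg ha _).trans haN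
  have hmul : n ^ (1 + 1 / E - η' / 2) ≤ (2 : ℝ) ^ (E + 1) * N := by
    rw [← hyE, Real.rpow_mul hn0.le]
    calc (n ^ y) ^ (E + 1) ≤ (2 * a) ^ (E + 1) := by gcongr
      _ = (2 : ℝ) ^ (E + 1) * a ^ (E + 1) := Real.mul_rpow (by norm_num) ha
      _ ≤ _ := by gcongr
  have hsplit : n ^ (1 + 1 / E - η) * n ^ (η' / 2) ≤ n ^ (1 + 1 / E - η' / 2) := by
    rw [← Real.rpow_add hn0]
    exact Real.rpow_le_rpow_of_exponent_le hn (by linarith)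
  have hchain : n ^ (1 + 1 / E - η) * n ^ (η' / 2) ≤ N * n ^ (η' / 2) := by
    refine (hsplit.trans hmul).trans ?_
    rw [mul_comm]
    gcongr
  exact le_of_mul_le_mul_right hchain (by positivity)

/-- The number of initial ports will be n^y with y slightly below 1/E. At γ = 0 the geometric sum is
E and yE < 1, so by continuity a small γ > 0 keeps the vertex exponent below 1. -/
theorem exists_exponents {E η' : ℝ} {κ : ℕ} (hE : E = (2 : ℝ) ^ (κ + 1) - 1) (hE1 : 1 ≤ E)
    (hη' : 0 < η') (hη'E : η' * E ≤ 1) : ∃ y γ : ℝ, y * (E + 1) = 1 + 1 / E - η' / 2 ∧ 0 < y ∧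
      0 < γ ∧ y * ∑ j ∈ Finset.range (κ + 1), (2 * (1 + γ)) ^ j < 1 := by
  set y := 1 / E - η' / (2 * (E + 1)) with hy
  have hyE1 : y * (E + 1) = 1 + 1 / E - η' / 2 := by
    rw [hy]
    field_simp
  have hy0 : 0 < y := by
    rw [hy, sub_pos, div_lt_div_iff₀ (by linarith) (by linarith)]
    nlinarith
  have hyE : y * E < 1 := by
    have : y * E = 1 - η' / (2 * (E + 1)) * E := by
      rw [hy]
      field_simp
    rw [this]
    have : 0 < η' / (2 * (E + 1)) * E := by positivity
    linarith
  have hcont : Continuous fun γ : ℝ => y * ∑ j ∈ Finset.range (κ + 1), (2 * (1 + γ)) ^ j := by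
    fun_prop
  have h0 : y * ∑ j ∈ Finset.range (κ + 1), (2 * (1 + (0 : ℝ))) ^ j < 1 := by
    have : ∑ j ∈ Finset.range (κ + 1), (2 * (1 + (0 : ℝ))) ^ j = E := by
      rw [add_zero, mul_one, geom_sum_eq (by norm_num), hE]
      norm_num
    rwa [this]
  have hev := (hcont.tendsto 0).eventually (gt_mem_nhds h0)
  obtain ⟨γ, hγ, hγ0⟩ := ((hev.filter_mono nhdsWithin_le_nhds).and
    (self_mem_nhdsWithin : ∀ᶠ γ in nhdsWithin (0 : ℝ) (Set.Ioi 0), γ ∈ Set.Ioi (0 : ℝ))).exists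
  exact ⟨y, γ, hyE1, hy0, hγ0, hγ⟩

set_option maxHeartbeats 800000 in
theorem exists_hasDenseGadgets {η : ℝ} (hη : 0 < η) {κ : ℕ} (hκ : 1 < κ) :
    ∃ θ : ℝ, 0 < θ ∧ HasDenseGadgets η θ κ := by
  set E : ℝ := (2 : ℝ) ^ (κ + 1) - 1 with hE
  have hE1 : 1 ≤ E := by
    have : (2 : ℝ) ^ 1 ≤ (2 : ℝ) ^ (κ + 1) := pow_le_pow_right₀ (by norm_num) (by omega)
    linarith
  -- Capping η at 1/E keeps y positive. Half of η' is spent on y, the other half on rounding n^y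
  -- down.
  set η' := min η (1 / E) with hη'
  have hη'0 : 0 < η' := lt_min hη (by positivity)
  have hη'E : η' * E ≤ 1 := by
    have := min_le_right η (1 / E)
    rwa [← hη', le_div_iff₀ (by linarith)] at this
  obtain ⟨y, γ, hyE1, hy0, hγ0, hγ⟩ := exists_exponents hE hE1 hη'0 hη'E
  set v := ∑ j ∈ Finset.range (κ + 1), (2 * (1 + γ)) ^ j with hv
  have hv0 : 0 ≤ v := Finset.sum_nonneg fun j _ => by positivity
  obtain ⟨Q, hQ, K, hrig⟩ := exists_hasRigid hγ0
  obtain ⟨h, hh, hgad⟩ := exists_hasGadget hγ0.le κ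
  have hlogQ : 0 ≤ Real.log Q := Real.log_nonneg hQ
  set B := h * ((K + 1) * (Real.log Q + 1)) with hB
  have hB0 : 0 ≤ B := by positivity
  -- The slack n^δ in the number of vertices pays for T^h.
  set δ := 1 - y * v with hδ
  have hδ0 : 0 < δ := by linarith
  refine ⟨min (δ / (B + 1)) (η' / (2 * (E + 1))), by positivity, ?_⟩
  intro n ε hε hε' hθ
  obtain ⟨hr, -, -⟩ := floor_bounds hκ hε hε'
  obtain ⟨-, hΛ⟩ := one_lt_log_inv hκ hε hε'
  have h3r := three_mul_floor_le hκ hε hε'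
  set r := ⌊1 / (6 * ε * κ)⌋₊
  set Λ := Real.log (1 / ε)
  have hκ2 : (2 : ℝ) ≤ κ := by exact_mod_cast hκ
  have hr1 : (1 : ℝ) ≤ r := by exact_mod_cast hr
  have hn : 0 < n := by
    rcases Nat.eq_zero_or_pos n with rfl | h
    · simp only [Nat.cast_zero, Real.log_zero, mul_zero] at hθ
      nlinarith
    · exact h
  have hn1 : (1 : ℝ) ≤ n := by exact_mod_cast hn
  have hn0 : (0 : ℝ) < n := by linarith
  have hL0 : 0 ≤ Real.log n := Real.log_nonneg hn1
  have hΛκ : Λ ≤ (κ : ℝ) ^ 2 * Λ := le_mul_of_one_le_left (by linarith) (by nlinarith)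
  have hΛ1 : B * Λ ≤ δ * Real.log n := by
    have h1 : Λ ≤ δ / (B + 1) * Real.log n := (hΛκ.trans hθ).trans (by gcongr; exact min_le_left _ _)
    rw [div_mul_eq_mul_div, le_div_iff₀ (by linarith)] at h1
    nlinarith
  have hΛ2 : (E + 1) * Λ ≤ η' / 2 * Real.log n := by
    have h1 : Λ ≤ η' / (2 * (E + 1)) * Real.log n :=
      (hΛκ.trans hθ).trans (by gcongr; exact min_le_right _ _)
    rw [div_mul_eq_mul_div, le_div_iff₀ (by linarith)] at h1
    nlinarith
  set T : ℝ := (3 * Q * r) ^ (K + 1) with hT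
  have h3Q : 3 * (r : ℝ) ≤ 3 * Q * r := by gcongr; linarith
  have hbase : 1 ≤ 3 * Q * r := by linarith
  have hT3 : 3 * (r : ℝ) ≤ T := h3Q.trans (le_self_pow₀ hbase (by omega))
  have hT0 : 0 < T := by positivity
  have hTQ : (Q * r) ^ K ≤ T := by
    calc (Q * r) ^ K ≤ (3 * Q * r) ^ K := by
          gcongr
          nlinarith
      _ ≤ T := pow_le_pow_right₀ hbase (by omega)
  have hTn : T ^ h ≤ (n : ℝ) ^ δ := scale_rpow_le hQ hr hh hn0 h3r hΛ hΛ1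
  set a := ⌊(n : ℝ) ^ y⌋₊ with ha
  have hny : 1 ≤ (n : ℝ) ^ y := Real.one_le_rpow hn1 hy0.le
  have ha0 : 0 < a := Nat.floor_pos.2 hny
  have ha1 : (1 : ℝ) ≤ a := by exact_mod_cast ha0
  have hale : (a : ℝ) ≤ (n : ℝ) ^ y := Nat.floor_le (by linarith)
  have hage : (n : ℝ) ^ y ≤ 2 * a := by
    have := Nat.lt_floor_add_one ((n : ℝ) ^ y)
    linarith
  obtain ⟨nA, nI, nV, hg, hA, -, hI, hV⟩ := hgad r a T hr ha0 hT3 fun b hb => by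
    obtain ⟨c, hc, hc'⟩ := hrig r b hr hb
    exact ⟨c, hc, hc'.trans (by gcongr)⟩
  refine ⟨nA, nI, nV, hg, lt_of_lt_of_le (lt_of_lt_of_le (pow_pos ha0 _) hA) hg.le, ?_, ?_⟩
  · have : (nV : ℝ) ≤ n := by
      calc (nV : ℝ) ≤ T ^ h * (a : ℝ) ^ v := hV
        _ ≤ (n : ℝ) ^ δ * ((n : ℝ) ^ y) ^ v := by gcongr
        _ = n := by
          rw [← Real.rpow_mul hn0.le, ← Real.rpow_add hn0, hδ, sub_add_cancel, Real.rpow_one]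
    exact_mod_cast this
  · have h2 : (2 : ℝ) ^ (E + 1) ≤ (n : ℝ) ^ (η' / 2) := by
      rw [← Real.log_le_log_iff (by positivity) (by positivity), Real.log_rpow (by norm_num),
        Real.log_rpow hn0]
      refine le_trans ?_ hΛ2
      have : Real.log 2 ≤ Λ := by linarith [Real.log_two_lt_d9]
      gcongr
    have hcast : (a : ℝ) ^ (E + 1) ≤ nI := by
      have e : E + 1 = ((2 ^ (κ + 1) : ℕ) : ℝ) := by
        rw [hE]
        push_cast
        ring
      rw [e, Real.rpow_natCast]
      exact_mod_cast hI
    exact rpow_le_of_rpow_le hn1 hyE1 (min_le_left _ _) h2 hage (by positivity) hcast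

/-- Only finitely many κ fall outside the large case, so a minimum of their θ's is still positive.
-/
theorem exists_hasDenseGadgets_uniform {η : ℝ} (hη : 0 < η) :
    ∃ θ : ℝ, 0 < θ ∧ ∀ κ : ℕ, 1 < κ → HasDenseGadgets η θ κ := by
  obtain ⟨K, hK⟩ : ∃ K : ℕ, ∀ κ ≥ K, 1 / ((2 : ℝ) ^ (κ + 1) - 1) ≤ η / 2 := by
    have hlim : Filter.Tendsto (fun κ : ℕ => 1 / ((2 : ℝ) ^ (κ + 1) - 1)) Filter.atTop (nhds 0) := by
      simp only [one_div]
      refine Filter.Tendsto.inv_tendsto_atTop ?_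
      refine Filter.tendsto_atTop_add_const_right _ _ ?_
      exact (tendsto_pow_atTop_atTop_of_one_lt (by norm_num)).comp (Filter.tendsto_add_atTop_nat 1)
    exact Filter.eventually_atTop.1 (hlim.eventually (ge_mem_nhds (by linarith)))
  have hsmall : ∀ K : ℕ, ∃ θ : ℝ, 0 < θ ∧ ∀ κ < K, 1 < κ → HasDenseGadgets η θ κ := by
    intro K
    induction K with
    | zero => exact ⟨1, one_pos, fun κ hκ => absurd hκ (by omega)⟩
    | succ K ih =>
      obtain ⟨θ, hθ, ih⟩ := ih
      by_cases hK : 1 < K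
      · obtain ⟨θ', hθ', h⟩ := exists_hasDenseGadgets hη hK
        refine ⟨min θ θ', lt_min hθ hθ', fun κ hκ hκ1 => ?_⟩
        rcases Nat.lt_succ_iff_lt_or_eq.1 hκ with hlt | rfl
        · exact (ih κ hlt hκ1).mono (min_le_left _ _)
        · exact h.mono (min_le_right _ _)
      · exact ⟨θ, hθ, fun κ hκ hκ1 => absurd hκ (by omega)⟩
  obtain ⟨θ, hθ, hsmall⟩ := hsmall K
  refine ⟨min θ (min (η / 2) 1), by positivity, fun κ hκ => ?_⟩
  rcases lt_or_ge κ K with hlt | hge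
  · exact (hsmall κ hlt hκ).mono (min_le_left _ _)
  · exact (hasDenseGadgets_of_large hκ (hK κ hge)).mono (min_le_right _ _)

theorem mainTheorem1 :
    ∃ c : ℝ, 0 < c ∧ ∃ N : Set ℕ, N.Infinite ∧
      ∀ η : ℝ, 0 < η → ∃ θ : ℝ, 0 < θ ∧
        ∀ n ∈ N, ∀ κ : ℕ, 1 < κ → (κ : ℝ) ≤ Real.logb 2 (Real.logb 2 (n : ℝ)) →
          ∀ ε : ℝ, 0 < ε → ε < 1 / (12 * (κ : ℝ)) →
            (κ : ℝ) ^ 2 * Real.log (1 / ε) ≤ θ * Real.log (n : ℝ) →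
              ∃ (G : WeightedGraph (Fin n)) (P : Finset (Fin n × Fin n)),
                (n : ℝ) ^ ((1 : ℝ) + 1 / ((2 : ℝ) ^ (κ + 1) - 1) - η) ≤ (P.card : ℝ) ∧
                ∀ S : SimpleGraph (Fin n), IsPairwiseSpanner G P (1 + ε) S →
                  (c / (ε * (κ : ℝ) ^ 2)) ^ κ * (P.card : ℝ) ≤ (S.edgeSet.ncard : ℝ) := by
  refine ⟨1 / 24, by norm_num, Set.univ, Set.infinite_univ, fun η hη => ?_⟩
  obtain ⟨θ, hθ, hdense⟩ := exists_hasDenseGadgets_uniform hη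
  refine ⟨θ, hθ, fun n _ κ hκ _ ε hε hε' hn => ?_⟩
  obtain ⟨nA, nI, nV, hg, hV0, hV, hI⟩ := hdense κ hκ n ε hε hε' hn
  obtain ⟨hr, hr1, hr2⟩ := floor_bounds hκ hε hε'
  set r := ⌊1 / (6 * ε * κ)⌋₊
  have hκ2 : (2 : ℝ) ≤ κ := by exact_mod_cast hκ
  have hr0 : (1 : ℝ) ≤ r := by exact_mod_cast hr
  obtain ⟨G, P, hP, hS⟩ := hg.exists_spanner_bound hV0 hV (by positivity) hε (by
    push_cast
    -- The choice 6εκr ≤ 1 gives 2εκr ≤ 1/3, and ε < 1/24.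
    have : ε * (1 + 2 * κ * r) ≤ 1 / 2 := by nlinarith [mul_pos hε (by linarith : (0 : ℝ) < r)]
    have hp : (0 : ℝ) ≤ (r : ℝ) ^ κ := by positivity
    nlinarith)
  refine ⟨G, P, by rwa [hP], fun S hSp => ?_⟩
  have hmain : ((r : ℝ) ^ κ * nI : ℝ) ≤ 4 * S.edgeSet.ncard := by exact_mod_cast hS S hSp
  have hc : 1 / 24 / (ε * (κ : ℝ) ^ 2) ≤ (r : ℝ) / 2 := by
    have h1 : 1 / 24 / (ε * (κ : ℝ) ^ 2) ≤ 1 / (12 * ε * κ) / 2 := by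
      rw [div_div, div_div]
      refine one_div_le_one_div_of_le (by positivity) ?_
      have : ε * κ * 1 ≤ ε * κ * κ := by gcongr; linarith
      nlinarith
    linarith
  -- Halving r, which is where 24 = 2 · 12 comes from, absorbs the factor 4 because κ ≥ 2.
  have h4 : (4 : ℝ) ≤ 2 ^ κ := by
    calc (4 : ℝ) = 2 ^ 2 := by norm_num
      _ ≤ 2 ^ κ := pow_le_pow_right₀ (by norm_num) hκ
  rw [hP]
  calc (1 / 24 / (ε * (κ : ℝ) ^ 2)) ^ κ * (nI : ℝ) ≤ ((r : ℝ) / 2) ^ κ * nI := by gcongr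
    _ = (r : ℝ) ^ κ * nI / 2 ^ κ := by rw [div_pow]; ring
    _ ≤ (r : ℝ) ^ κ * nI / 4 := by gcongr
    _ ≤ S.edgeSet.ncard := by linarith
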